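/- **Theorem 3.1.** Fix an integer $q\ge 1$. All graphs are undirected and may have multiple edges and loops. For a graph $G=(V,E)$ let $\vec E$ be its set of directed edges, in which every edge of $E$ (loops included) gives two distinct, mutually inverse directed edges $e,\overline e$; write $o(e),t(e)$ for the origin and the terminus of $e\in\vec E$. $G$ is $(q+1)$-regular if every vertex is the origin of exactly $q+1$ directed edges. For a finite nonempty $(q+1)$-regular graph $G$ with adjacency matrix $A$, $A_{ij}=\#\{e\in\vec E: o(e)=i,\ t(e)=j\}$, and eigenvalues $\lambda_1,\dots,\lambda_{|V|}$ of $A$ (with multiplicity), put $$\mu(G)=\frac1{|V|}\sum_{k=1}^{|V|}\delta_{q^{-1/2}\lambda_k}.$$ For a subgroup $\mathcal G$ of the unitary group $U(N)$, $N\ge 1$, a $\mathcal G$-color on $G$ is a map $\sigma:\vec E\to\mathcal G$ with $\sigma(\overline e)=\sigma(e)^{-1}$ for all $e$. Let $A^\sigma$ be the Hermitian $N|V|\times N|V|$ block matrix with $N\times N$ blocks $(A^\sigma)_{ij}=\sum_{e\in\vec E:\,o(e)=i,\,t(e)=j}\sigma(e)$ for $i,j\in V$, with eigenvalues $\lambda_1^\sigma,\dots,\lambda_{N|V|}^\sigma$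 (with multiplicity), and put $$\mu(G,\sigma)=\frac1{N|V|}\sum_{k=1}^{N|V|}\delta_{q^{-1/2}\lambda^\sigma_k}.$$ The Kesten–McKay law $\mu_q$ is the unique probability measure of bounded support on $\mathbb R$ such that $\int P\,d\mu_q=\langle \mathbf 1_v,P(q^{-1/2}A)\mathbf 1_v\rangle$ for every real polynomial $P$, where $A$ is the adjacency operator of the $(q+1)$-regular tree and $v$ is any of its vertices. Let $(G_n)_{n\ge0}$ be a sequence of finite nonempty $(q+1)$-regular graphs, and for every $n$ let $\mathcal G_n$ be a subgroup of $U(N_n)$, $N_n\ge1$. Then $\mu(G_n)$ converges weakly to $\mu_q$ as $n\to\infty$ if and only if, for every choice of $\mathcal G_n$-colors $\sigma_n$ on $G_n$ ($n\ge 0$), $\mu(G_n,\sigma_n)$ converges weakly to $\mu_q$ as $n\to\infty$. -/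

import Mathlib

open MeasureTheory Filter Topology

noncomputable section

/-- An undirected graph with vertex set `V`, possibly with multiple edges and multiple loops, given
by its set `D` of directed edges: every directed edge `e` has an origin `o e`, a terminus `t e` and
an inverse `inv e ≠ e`.  The undirected edges are the pairs `{e, inv e}`, so every undirected edge,
loops included, gives exactly two directed edges. -/
structure Multigraph (V D : Type*) where
  o : D → V
  t : D → V
  inv : D → D
  inv_inv : ∀ e, inv (inv e) = e
  inv_ne : ∀ e, inv e ≠ e
  o_inv : ∀ e, o (inv e) = t e

namespace Multigraph

variable {V D : Type*} (G : Multigraph V D)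

theorem t_inv (e : D) : G.t (G.inv e) = G.o e := by
  rw [← G.o_inv, G.inv_inv]

/-- Every vertex is the origin of exactly `d` directed edges (a loop contributes `2`). -/
def IsRegular (d : ℕ) : Prop :=
  ∀ v, Nat.card {e : D // G.o e = v} = d

/-! ### Finite graphs -/

/-- The adjacency matrix: the `(i, j)` entry is the number of directed edges from `i` to `j`. -/
def adjMatrix [Fintype D] [DecidableEq V] : Matrix V V ℝ :=
  Matrix.of fun i j => ∑ e : D, if G.o e = i ∧ G.t e = j then 1 else 0

/-- The permutation of the directed edges that inverts each of them. -/
def invEquiv : D ≃ D := ⟨G.inv, G.inv, G.inv_inv, G.inv_inv⟩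

theorem adjMatrix_isHermitian [Fintype D] [DecidableEq V] : G.adjMatrix.IsHermitian := by
  refine Matrix.IsHermitian.ext fun i j => ?_
  simp only [adjMatrix, Matrix.of_apply, star_trivial]
  refine Fintype.sum_equiv G.invEquiv _ _ fun e => ?_
  simp [invEquiv, G.o_inv, G.t_inv, and_comm]

/-- For a subgroup `𝒢` of the unitary group `U(N)`: a `𝒢`-color on `G`, i.e. an assignment of an
element of `𝒢` to every directed edge such that inverse edges get inverse elements. -/
structure Color {N : ℕ} (𝒢 : Subgroup (Matrix.unitaryGroup (Fin N) ℂ)) where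
  toFun : D → 𝒢
  map_inv : ∀ e, toFun (G.inv e) = (toFun e)⁻¹

variable {G}

/-- The unitary matrix attached by a color to a directed edge. -/
def Color.mat {N : ℕ} {𝒢 : Subgroup (Matrix.unitaryGroup (Fin N) ℂ)} (σ : G.Color 𝒢) (e : D) :
    Matrix (Fin N) (Fin N) ℂ :=
  ((σ.toFun e : Matrix.unitaryGroup (Fin N) ℂ) : Matrix (Fin N) (Fin N) ℂ)

/-- The colored adjacency matrix `A^σ`, whose `(i, j)` block is the sum of the matrices of the
directed edges from `i` to `j`. -/
def Color.adjMatrix [Fintype D] [DecidableEq V] {N : ℕ}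
    {𝒢 : Subgroup (Matrix.unitaryGroup (Fin N) ℂ)} (σ : G.Color 𝒢) :
    Matrix (V × Fin N) (V × Fin N) ℂ :=
  Matrix.of fun x y =>
    ∑ e : D, if G.o e = x.1 ∧ G.t e = y.1 then σ.mat e x.2 y.2 else 0

theorem Color.mat_inv {N : ℕ} {𝒢 : Subgroup (Matrix.unitaryGroup (Fin N) ℂ)} (σ : G.Color 𝒢)
    (e : D) : σ.mat (G.inv e) = star (σ.mat e) := by
  simp only [Color.mat, σ.map_inv]
  rfl

theorem Color.adjMatrix_isHermitian [Fintype D] [DecidableEq V] {N : ℕ}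
    {𝒢 : Subgroup (Matrix.unitaryGroup (Fin N) ℂ)} (σ : G.Color 𝒢) :
    σ.adjMatrix.IsHermitian := by
  refine Matrix.IsHermitian.ext fun x y => ?_
  simp only [Color.adjMatrix, Matrix.of_apply, star_sum]
  refine Fintype.sum_equiv G.invEquiv _ _ fun e => ?_
  simp only [invEquiv, Equiv.coe_fn_mk, G.o_inv, G.t_inv, Color.mat_inv, Matrix.star_apply]
  rw [apply_ite star, star_zero]
  exact if_congr and_comm rfl rfl

end Multigraph

/-- The probability measure `(1 / n) ∑ₖ δ_{c λₖ}`, where `λ₁, …, λₙ` are the eigenvalues, with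
multiplicity, of an `n × n` Hermitian matrix, `n ≥ 1`. -/
def empiricalSpectralMeasure {𝕜 ι : Type*} [RCLike 𝕜] [Fintype ι] [DecidableEq ι] [Nonempty ι]
    (c : ℝ) {A : Matrix ι ι 𝕜} (hA : A.IsHermitian) : ProbabilityMeasure ℝ :=
  ⟨(Fintype.card ι : ENNReal)⁻¹ • ∑ k : ι, Measure.dirac (c * hA.eigenvalues k), ⟨by
    simp only [Measure.smul_apply, Measure.coe_finsetSum, Finset.sum_apply, measure_univ,
      Finset.sum_const, Finset.card_univ, nsmul_eq_mul, mul_one, smul_eq_mul]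
    exact ENNReal.inv_mul_cancel (by simp) (by simp)⟩⟩

namespace Multigraph

variable {V D : Type*} [Fintype V] [DecidableEq V] [Nonempty V] [Fintype D]

/-- The normalized spectral measure `μ(G)` of a finite `(q+1)`-regular graph. -/
def spectralMeasure (G : Multigraph V D) (q : ℕ) : ProbabilityMeasure ℝ :=
  empiricalSpectralMeasure (Real.sqrt q)⁻¹ G.adjMatrix_isHermitian

/-- The normalized spectral measure `μ(G, σ)` of a finite `(q+1)`-regular graph with a color. -/
def Color.spectralMeasure {G : Multigraph V D} {N : ℕ} [NeZero N]
    {𝒢 : Subgroup (Matrix.unitaryGroup (Fin N) ℂ)} (σ : G.Color 𝒢) (q : ℕ) :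
    ProbabilityMeasure ℝ :=
  empiricalSpectralMeasure (Real.sqrt q)⁻¹ σ.adjMatrix_isHermitian

end Multigraph

/-! ### The regular tree and the Kesten–McKay law -/

namespace Multigraph

variable {V D : Type*} (G : Multigraph V D)

/-- The adjacency operator `(A f)(v) = ∑_{o(e) = v} f(t(e))` of a locally finite graph.  It is
defined on all functions on the vertices and restricts to the usual operator on `ℓ²(V)`. -/
def adjOp [∀ v, Fintype {e : D // G.o e = v}] : (V → ℝ) →ₗ[ℝ] (V → ℝ) where
  toFun f v := ∑ e : {e : D // G.o e = v}, f (G.t e)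
  map_add' f g := by ext v; simp [Finset.sum_add_distrib]
  map_smul' c f := by ext v; simp [Finset.mul_sum]

/-- `μ` is the normalized spectral measure at the vertex `v` of the locally finite graph `G`,
supposed `(q+1)`-regular: it has bounded support and, for every polynomial `P`,
`∫ P dμ = ⟨1_v, P(q^{-1/2} A) 1_v⟩`, the value at `v` of `P(q^{-1/2} A) 1_v`. -/
def IsSpectralMeasureAt [DecidableEq V] [∀ v, Fintype {e : D // G.o e = v}] (q : ℕ) (v : V)
    (μ : ProbabilityMeasure ℝ) : Prop :=
  (∃ R : ℝ, (μ : Measure ℝ) (Set.Icc (-R) R)ᶜ = 0) ∧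
    ∀ P : Polynomial ℝ, ∫ x, P.eval x ∂(μ : Measure ℝ) =
      (Polynomial.aeval ((Real.sqrt q)⁻¹ • G.adjOp) P) (Pi.single v 1) v

end Multigraph

/-- The free product of `d` copies of the group with two elements. -/
abbrev FreeInvolutions (d : ℕ) : Type :=
  Monoid.CoprodI fun _ : Fin d => Multiplicative (ZMod 2)

/-- The generators of the free product, which are involutions. -/
def FreeInvolutions.gen {d : ℕ} (i : Fin d) : FreeInvolutions d :=
  Monoid.CoprodI.of (M := fun _ : Fin d => Multiplicative (ZMod 2)) (i := i)
    (Multiplicative.ofAdd (1 : ZMod 2))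

theorem FreeInvolutions.gen_mul_gen {d : ℕ} (i : Fin d) : gen i * gen i = 1 := by
  rw [gen, ← map_mul, ← ofAdd_add, show (1 + 1 : ZMod 2) = 0 from rfl, ofAdd_zero, map_one]

theorem FreeInvolutions.gen_ne_one {d : ℕ} (i : Fin d) : gen i ≠ 1 := by
  intro h
  rw [gen, ← map_one (Monoid.CoprodI.of (M := fun _ : Fin d => Multiplicative (ZMod 2)) (i := i))]
    at h
  exact absurd (Monoid.CoprodI.of_injective i h) (by decide)

open FreeInvolutions in
/-- The `d`-regular tree, as the Cayley graph of the free product of `d` copies of the group with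
two elements: the directed edge `(g, i)` goes from `g` to `g * gen i`. -/
def regularTree (d : ℕ) : Multigraph (FreeInvolutions d) (FreeInvolutions d × Fin d) where
  o e := e.1
  t e := e.1 * gen e.2
  inv e := (e.1 * gen e.2, e.2)
  inv_inv e := by simp [mul_assoc, gen_mul_gen]
  inv_ne e h := gen_ne_one e.2 (by simpa using congrArg Prod.fst h)
  o_inv _ := rfl

/-- The directed edges of the regular tree that start at `g`. -/
def regularTreeStar {d : ℕ} (g : FreeInvolutions d) :
    Fin d ≃ {e : FreeInvolutions d × Fin d // (regularTree d).o e = g} where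
  toFun i := ⟨(g, i), rfl⟩
  invFun e := e.1.2
  left_inv _ := rfl
  right_inv := by rintro ⟨⟨h, i⟩, rfl⟩; rfl

instance regularTreeFintype {d : ℕ} (g : FreeInvolutions d) :
    Fintype {e : FreeInvolutions d × Fin d // (regularTree d).o e = g} :=
  Fintype.ofEquiv _ (regularTreeStar g)

theorem regularTree_isRegular (d : ℕ) : (regularTree d).IsRegular d := fun g => by
  rw [← Nat.card_congr (regularTreeStar g), Nat.card_eq_fintype_card, Fintype.card_fin]

/-- `regularTree d` is connected. -/
theorem regularTree_connected {d : ℕ} (g h : FreeInvolutions d) :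
    ∃ l : List (Fin d), g * (l.map FreeInvolutions.gen).prod = h := by
  suffices H : ∀ x : FreeInvolutions d, ∃ l : List (Fin d), (l.map FreeInvolutions.gen).prod = x by
    obtain ⟨l, hl⟩ := H (g⁻¹ * h)
    exact ⟨l, by rw [hl]; group⟩
  intro x
  induction x using Monoid.CoprodI.induction_on with
  | one => exact ⟨[], rfl⟩
  | of i m =>
    have hm : m = Multiplicative.ofAdd 0 ∨ m = Multiplicative.ofAdd 1 := by
      revert m; decide
    rcases hm with rfl | rfl
    · exact ⟨[], by simp⟩
    · exact ⟨[i], by simp [FreeInvolutions.gen]⟩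
  | mul x y hx hy =>
    obtain ⟨l, rfl⟩ := hx
    obtain ⟨l', rfl⟩ := hy
    exact ⟨l ++ l', by simp⟩

/-- `regularTree d` has no closed non-backtracking walk of positive length.  Such a walk starting
at `g` traverses the edges `(g, i₁), (g * gen i₁, i₂), …` with `iₖ ≠ iₖ₊₁`. -/
theorem regularTree_acyclic {d : ℕ} (g : FreeInvolutions d) (l : List (Fin d)) (hl : l ≠ [])
    (hc : l.IsChain (· ≠ ·)) : g * (l.map FreeInvolutions.gen).prod ≠ g := by
  intro h
  rw [mul_eq_left] at h
  let w : Monoid.CoprodI.Word fun _ : Fin d => Multiplicative (ZMod 2) :=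
    { toList := l.map fun i => ⟨i, Multiplicative.ofAdd 1⟩
      ne_one := by
        intro x hx
        obtain ⟨i, -, rfl⟩ := List.mem_map.1 hx
        show Multiplicative.ofAdd (1 : ZMod 2) ≠ 1
        decide
      chain_ne := by
        rw [List.isChain_map]
        exact hc }
  have hw : w.prod = Monoid.CoprodI.Word.empty.prod := by
    rw [Monoid.CoprodI.Word.prod_empty, ← h]
    simp only [w, Monoid.CoprodI.Word.prod, List.map_map, Function.comp_def]
    rfl
  have := Monoid.CoprodI.Word.equiv.symm.injective (a₁ := w) (a₂ := .empty) hw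
  apply hl
  have h2 := congrArg Monoid.CoprodI.Word.toList this
  simpa [w, Monoid.CoprodI.Word.empty] using h2

/-- Existence of the spectral measure of a bounded self-adjoint operator at a unit vector. -/
theorem exists_spectralMeasure {H : Type*} [NormedAddCommGroup H] [InnerProductSpace ℂ H]
    [CompleteSpace H] (T : H →L[ℂ] H) (hT : IsSelfAdjoint T) (x : H) (hx : ‖x‖ = 1) :
    ∃ μ : ProbabilityMeasure ℝ, (∃ R : ℝ, (μ : Measure ℝ) (Set.Icc (-R) R)ᶜ = 0) ∧
      ∀ P : Polynomial ℝ, ∫ y, P.eval y ∂(μ : Measure ℝ) =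
        (inner ℂ (Polynomial.aeval T P x) x).re := by
  classical
  let X := spectrum ℝ T
  have : CompactSpace X := isCompact_iff_compactSpace.1 (spectrum.isCompact T)
  let L : CompactlySupportedContinuousMap X ℝ →ₗ[ℝ] ℝ :=
    { toFun := fun f => (inner ℂ (cfcHom hT (f : C(X, ℝ)) x) x).re
      map_add' := fun f g => by
        have : ((f + g : CompactlySupportedContinuousMap X ℝ) : C(X, ℝ)) =
          (f : C(X, ℝ)) + (g : C(X, ℝ)) := rfl
        rw [this, map_add, add_apply, inner_add_left, Complex.add_re]
      map_smul' := fun c f => by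
        have : ((c • f : CompactlySupportedContinuousMap X ℝ) : C(X, ℝ)) =
          c • (f : C(X, ℝ)) := rfl
        rw [this, map_smul, smul_apply, ← Complex.coe_smul, inner_smul_left]
        simp }
  have hL : ∀ f, 0 ≤ f → 0 ≤ L f := fun f hf => by
    have h1 : 0 ≤ cfcHom hT (f : C(X, ℝ)) := by
      rw [cfcHom_nonneg_iff]
      exact fun y => hf y
    rw [ContinuousLinearMap.nonneg_iff_isPositive] at h1
    exact h1.re_inner_nonneg_left x
  let Λ : CompactlySupportedContinuousMap X ℝ →ₚ[ℝ] ℝ := PositiveLinearMap.mk₀ L hL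
  let ν := RealRMK.rieszMeasure Λ
  have key : ∀ P : Polynomial ℝ, ∫ y : X, P.eval (y : ℝ) ∂ν =
      (inner ℂ (Polynomial.aeval T P x) x).re := fun P => by
    let f : CompactlySupportedContinuousMap X ℝ :=
      ⟨⟨fun y => P.eval (y : ℝ), by fun_prop⟩, HasCompactSupport.of_compactSpace _⟩
    have h1 := RealRMK.integral_rieszMeasure Λ f
    have h2 : cfcHom hT (f : C(X, ℝ)) = Polynomial.aeval T P := by
      rw [← cfc_polynomial P T, cfc_apply _ T]
      rfl
    rw [← h2]
    exact h1
  have : IsFiniteMeasure ν := inferInstance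
  have hν : ν Set.univ = 1 := by
    have h1 := key 1
    simp only [Polynomial.eval_one, integral_const, smul_eq_mul, mul_one, map_one] at h1
    rw [show (inner ℂ ((1 : H →L[ℂ] H) x) x).re = 1 by
      rw [one_apply_eq_self, inner_self_eq_norm_sq_to_K, hx]; simp] at h1
    rw [Measure.real, ENNReal.toReal_eq_one_iff] at h1
    exact h1
  have hmeas : Measurable (Subtype.val : X → ℝ) := measurable_subtype_coe
  have hemb : MeasurableEmbedding (Subtype.val : X → ℝ) :=
    MeasurableEmbedding.subtype_coe (spectrum.isCompact T).measurableSet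
  have : IsProbabilityMeasure ν := ⟨hν⟩
  refine ⟨⟨ν.map Subtype.val, Measure.isProbabilityMeasure_map hmeas.aemeasurable⟩,
    ⟨‖T‖ * ‖(1 : H →L[ℂ] H)‖, ?_⟩, fun P => ?_⟩
  · rw [ProbabilityMeasure.coe_mk, Measure.map_apply hmeas measurableSet_Icc.compl]
    convert measure_empty (μ := ν)
    ext y
    simp only [Set.mem_preimage, Set.mem_compl_iff, Set.mem_Icc, Set.mem_empty_iff_false, iff_false,
      not_not]
    exact abs_le.1 (spectrum.norm_le_norm_mul_of_mem y.2)
  · rw [ProbabilityMeasure.coe_mk, hemb.integral_map]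
    exact key P

/-- Composition with a permutation of the index set, as an operator on `ℓ²`. -/
theorem exists_lp_comp {V : Type*} (s : Equiv.Perm V) :
    ∃ U : lp (fun _ : V => ℂ) 2 →L[ℂ] lp (fun _ : V => ℂ) 2, ∀ f v, U f v = f (s v) := by
  have h2 : 0 < (2 : ENNReal).toReal := by norm_num
  have hmem : ∀ f : lp (fun _ : V => ℂ) 2,
      Memℓp (E := fun _ : V => ℂ) (fun v => f (s v)) 2 := fun f => by
    have := (lp.memℓp f).summable h2
    exact memℓp_gen ((s.summable_iff (f := fun v => ‖f v‖ ^ (2 : ENNReal).toReal)).2 this)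
  let U : lp (fun _ : V => ℂ) 2 →ₗ[ℂ] lp (fun _ : V => ℂ) 2 :=
    { toFun := fun f => ⟨fun v => f (s v), hmem f⟩
      map_add' := fun f g => by ext v; rfl
      map_smul' := fun c f => by ext v; rfl }
  refine ⟨U.mkContinuous 1 fun f => ?_, fun f v => rfl⟩
  rw [one_mul, lp.norm_eq_tsum_rpow h2, lp.norm_eq_tsum_rpow h2]
  exact le_of_eq (congrArg (· ^ (1 / (2 : ENNReal).toReal))
    (s.tsum_eq (fun v => ‖f v‖ ^ (2 : ENNReal).toReal)))

/-- A real-linear map that intertwines `T` and `B` intertwines `P(T)` and `P(B)`. -/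
theorem map_aeval_of_intertwine {H W : Type*} [NormedAddCommGroup H] [InnerProductSpace ℂ H]
    [CompleteSpace H] [AddCommGroup W] [Module ℝ W] (T : H →L[ℂ] H) (B : W →ₗ[ℝ] W) (ρ : H →+ W)
    (hρ : ∀ (r : ℝ) f, ρ ((r : ℂ) • f) = r • ρ f) (hB : ∀ f, ρ (T f) = B (ρ f))
    (P : Polynomial ℝ) (f : H) : ρ (Polynomial.aeval T P f) = Polynomial.aeval B P (ρ f) := by
  have hρ' : ∀ (r : ℝ) f, ρ (r • f) = r • ρ f := fun r f => by rw [← hρ, Complex.coe_smul]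
  induction P using Polynomial.induction_on' generalizing f with
  | add P Q hP hQ => simp [hP, hQ]
  | monomial n a =>
    rw [Polynomial.aeval_monomial, Polynomial.aeval_monomial]
    simp only [Algebra.algebraMap_eq_smul_one, smul_mul_assoc, one_mul, LinearMap.smul_apply]
    rw [smul_apply, hρ']
    congr 1
    induction n generalizing f with
    | zero => simp
    | succ n ih => rw [pow_succ, pow_succ, mul_apply_eq_comp, Module.End.mul_apply, ih, hB]

open FreeInvolutions in
/-- Existence of the normalized spectral measure of the regular tree. -/
theorem exists_isSpectralMeasureAt_regularTree (q : ℕ) :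
    ∃ μ : ProbabilityMeasure ℝ, (regularTree (q + 1)).IsSpectralMeasureAt q 1 μ := by
  let s : Fin (q + 1) → Equiv.Perm (FreeInvolutions (q + 1)) := fun i =>
    ⟨fun v => v * gen i, fun v => v * gen i, fun v => by simp only [mul_assoc, gen_mul_gen, mul_one],
      fun v => by simp only [mul_assoc, gen_mul_gen, mul_one]⟩
  choose U hU using fun i => exists_lp_comp (s i)
  have hs : ∀ i v, s i (s i v) = v := fun i v => (s i).left_inv v
  have hsymm : ∀ i, IsSelfAdjoint (U i) := fun i => by
    rw [ContinuousLinearMap.isSelfAdjoint_iff_isSymmetric]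
    intro f g
    simp only [ContinuousLinearMap.coe_coe]
    rw [lp.inner_eq_tsum, lp.inner_eq_tsum, ← (s i).tsum_eq]
    simp only [hU, hs]
  let c : ℝ := (Real.sqrt q)⁻¹
  let T : lp (fun _ : FreeInvolutions (q + 1) => ℂ) 2 →L[ℂ]
    lp (fun _ : FreeInvolutions (q + 1) => ℂ) 2 := (c : ℂ) • ∑ i, U i
  have hT : IsSelfAdjoint T :=
    IsSelfAdjoint.smul (Complex.conj_ofReal c) (isSelfAdjoint_sum _ fun i _ => hsymm i)
  let x : lp (fun _ : FreeInvolutions (q + 1) => ℂ) 2 := lp.single 2 1 (1 : ℂ)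
  have hx : ‖x‖ = 1 := by
    rw [lp.norm_single (by norm_num)]; simp
  obtain ⟨μ, hμ, hP⟩ := exists_spectralMeasure T hT x hx
  refine ⟨μ, hμ, fun P => (hP P).trans ?_⟩
  let ρ : lp (fun _ : FreeInvolutions (q + 1) => ℂ) 2 →+ (FreeInvolutions (q + 1) → ℝ) :=
    { toFun := fun f v => (f v).re
      map_zero' := by ext v; simp
      map_add' := fun f g => by ext v; simp }
  have hρ : ∀ (r : ℝ) f, ρ ((r : ℂ) • f) = r • ρ f := fun r f => by
    ext v
    exact Complex.re_ofReal_mul r (f v)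
  have hB : ∀ f, ρ (T f) = (c • (regularTree (q + 1)).adjOp) (ρ f) := fun f => by
    have h0 : (∑ i, U i) f = ∑ i, U i f := by simp
    have h1 : T f = (c : ℂ) • (∑ i, U i) f := rfl
    rw [h1, h0, hρ, map_sum, LinearMap.smul_apply]
    congr 1
    ext v
    rw [Finset.sum_apply]
    exact Fintype.sum_equiv (regularTreeStar v) _ _ fun i => congrArg Complex.re (hU i f v)
  have hρx : ρ x = Pi.single 1 1 := by
    ext v
    by_cases h : v = 1
    · subst h; simp [ρ, x]
    · simp [ρ, x, h]
  have h3 : ∀ y, (inner ℂ y x).re = ρ y 1 := fun y => by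
    rw [lp.inner_single_right]
    simp [ρ]
  refine (h3 _).trans ?_
  rw [← hρx]
  exact congrFun (map_aeval_of_intertwine T _ ρ hρ hB P x) 1

/-- The Kesten–McKay law `μ_q`: the normalized spectral measure of the `(q+1)`-regular tree, i.e.
the (unique) probability measure of bounded support with
`∫ P dμ_q = ⟨1_v, P(q^{-1/2} A) 1_v⟩` for all polynomials `P`. -/
def kestenMcKay (q : ℕ) : ProbabilityMeasure ℝ :=
  (exists_isSpectralMeasureAt_regularTree q).choose

theorem kestenMcKay_spec (q : ℕ) :
    (regularTree (q + 1)).IsSpectralMeasureAt q 1 (kestenMcKay q) :=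
  (exists_isSpectralMeasureAt_regularTree q).choose_spec

end

open MeasureTheory Filter Topology

noncomputable section

/-! Spectral measures are tested on polynomials adapted to regular graphs. For r ≥ 1 let F_r be the
polynomial for which F_r(A) counts non-backtracking walks of length r in any (q+1)-regular graph
(`nbPoly`). The three-term recurrence behind F_r only uses that an edge followed by its inverse acts
as the identity. A color satisfies this too, so F_r(A^σ) sums the ordered products of σ along the
same walks (`starSum_nbWalkSum`). These products are unitary, so each diagonal entry of F_r(A^σ) is
at most the corresponding entry of F_r(A) in absolute value, and the normalized traces inherit the
bound (`Color.abs_integral_nbPoly_le`).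

The tree has no closed non-backtracking walk of positive length, so μ_q integrates every rescaled
F_r with r ≥ 1 to 0 (`integral_kestenMcKay_nbPoly`). All measures live on one compact interval and
the F_r span the polynomials, so weak convergence to μ_q means that these integrals tend to 0
(`tendsto_iff_forall_integral_nbPoly`). Because the limit is 0, the domination passes convergence
from G_n to every coloring. Conversely, the trivial color has the same polynomial integrals as the
uncolored graph. -/

namespace Multigraph

/-! ### Twisted adjacency operators and non-backtracking sums -/

section NonBacktracking

variable {V D M : Type*} (G : Multigraph V D) [∀ v, Fintype {e : D // G.o e = v}]
  [AddCommGroup M]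

/-- The sum of a function over the directed edges that start at `v`. -/
def starSum (v : V) (h : D → M) : M := ∑ e : {e : D // G.o e = v}, h e

variable {G}

theorem starSum_congr {v : V} {h k : D → M} (H : ∀ e, G.o e = v → h e = k e) :
    G.starSum v h = G.starSum v k :=
  Finset.sum_congr rfl fun e _ => H e e.2

theorem starSum_add (v : V) (h k : D → M) :
    G.starSum v (fun e => h e + k e) = G.starSum v h + G.starSum v k :=
  Finset.sum_add_distrib

theorem starSum_sub (v : V) (h k : D → M) :
    G.starSum v (fun e => h e - k e) = G.starSum v h - G.starSum v k :=
  Finset.sum_sub_distrib _ _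

theorem starSum_const [Module ℝ M] {d : ℕ} (hG : G.IsRegular d) (v : V) (m : M) :
    G.starSum v (fun _ => m) = (d : ℝ) • m := by
  have := hG v
  rw [Nat.card_eq_fintype_card] at this
  rw [starSum, Finset.sum_const, Finset.card_univ, this, Nat.cast_smul_eq_nsmul]

/-- Removing one edge from a star is how the ban on backtracking becomes a subtraction. -/
theorem starSum_erase [DecidableEq D] (h : D → M) (e : D) :
    G.starSum (G.o e) (fun f => if f = e then 0 else h f) = G.starSum (G.o e) h - h e := by
  rw [eq_sub_iff_add_eq]
  have h1 : G.starSum (G.o e) (fun f => if f = e then h f else 0) = h e := by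
    rw [starSum, Fintype.sum_eq_single (⟨e, rfl⟩ : {f : D // G.o f = G.o e})]
    · simp
    · intro f hf
      exact if_neg fun h => hf (Subtype.ext h)
  rw [← h1, ← starSum_add]
  exact starSum_congr fun f _ => by split_ifs <;> simp

variable (G) [Module ℝ M]

/-- The adjacency operator twisted by a linear map for every directed edge. -/
def twistedAdjOp (u : D → M →ₗ[ℝ] M) : (V → M) →ₗ[ℝ] (V → M) where
  toFun g v := G.starSum v fun e => u e (g (G.t e))
  map_add' g h := by ext v; simp [starSum, Finset.sum_add_distrib]
  map_smul' c g := by ext v; simp [starSum, Finset.smul_sum]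

theorem twistedAdjOp_id : G.twistedAdjOp (fun _ => (LinearMap.id : ℝ →ₗ[ℝ] ℝ)) = G.adjOp := rfl

/-- The sum of `g`, transported along the walk, over the non-backtracking walks of length `r + 1`
with first edge `e`. -/
def nbWalkSum [DecidableEq D] (u : D → M →ₗ[ℝ] M) (g : V → M) : ℕ → D → M
  | 0, e => u e (g (G.t e))
  | r + 1, e => u e (G.starSum (G.t e) fun f => if f = G.inv e then 0 else nbWalkSum u g r f)

end NonBacktracking

end Multigraph

/-! ### Non-backtracking polynomials -/

open Polynomial in
/-- The polynomial in the adjacency operator of a `(q+1)`-regular graph that counts the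
non-backtracking walks of length `r`. -/
def nbPoly (q : ℕ) : ℕ → ℝ[X]
  | 0 => 1
  | 1 => X
  -- The subtracted terms are the walks whose first two steps cancel. Cancelling down to length 0
  -- can happen along any of q + 1 edges; if a nonempty walk is left, its own first edge is
  -- excluded, so q remain.
  | 2 => X * X - C (q + 1 : ℝ)
  | r + 3 => X * nbPoly q (r + 2) - C (q : ℝ) * nbPoly q (r + 1)

open Polynomial in
-- The recurrence makes the span stable under multiplication by X, and the span contains 1.
theorem span_nbPoly (q : ℕ) (S : Submodule ℝ ℝ[X]) (hS : ∀ r, nbPoly q r ∈ S) : S = ⊤ := by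
  have h1 : ∀ P ∈ Submodule.span ℝ (Set.range (nbPoly q)),
      X * P ∈ Submodule.span ℝ (Set.range (nbPoly q)) := fun P hP => by
    have hmem : ∀ r, nbPoly q r ∈ Submodule.span ℝ (Set.range (nbPoly q)) := fun r =>
      Submodule.subset_span ⟨r, rfl⟩
    induction hP using Submodule.span_induction with
    | mem P hP =>
      obtain ⟨r, rfl⟩ := hP
      match r with
      | 0 => simpa [nbPoly] using hmem 1
      | 1 =>
        have : X * nbPoly q 1 = nbPoly q 2 + (q + 1 : ℝ) • nbPoly q 0 := by
          simp only [nbPoly, smul_eq_C_mul]; ring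
        rw [this]
        exact add_mem (hmem _) (Submodule.smul_mem _ _ (hmem _))
      | r + 2 =>
        have : X * nbPoly q (r + 2) = nbPoly q (r + 3) + (q : ℝ) • nbPoly q (r + 1) := by
          rw [nbPoly.eq_4, smul_eq_C_mul]; ring
        rw [this]
        exact add_mem (hmem _) (Submodule.smul_mem _ _ (hmem _))
    | zero => simp
    | add P Q _ _ hP hQ => rw [mul_add]; exact add_mem hP hQ
    | smul c P _ hP => rw [mul_smul_comm]; exact Submodule.smul_mem _ _ hP
  rw [eq_top_iff]
  rintro P -
  refine Submodule.span_le.2 (Set.range_subset_iff.2 hS) ?_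
  clear * - h1
  induction P using Polynomial.induction_on' with
  | add P Q hP hQ => exact add_mem hP hQ
  | monomial n a =>
    rw [← C_mul_X_pow_eq_monomial, ← smul_eq_C_mul]
    refine Submodule.smul_mem _ _ ?_
    induction n with
    | zero => exact Submodule.subset_span ⟨0, by simp [nbPoly]⟩
    | succ n ih => rw [pow_succ']; exact h1 _ ih

/-! ### Walk sums as polynomials in the operator -/

namespace Multigraph

section NonBacktracking

variable {V D M : Type*} {G : Multigraph V D} [∀ v, Fintype {e : D // G.o e = v}]
  [AddCommGroup M] [Module ℝ M] [DecidableEq D]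

/-- Prepend an edge to a non-backtracking walk: either the result is still non-backtracking, or the
walk began with the inverse of that edge. -/
theorem twistedAdjOp_starSum (u : D → M →ₗ[ℝ] M) (g : V → M) (r : ℕ) (v : V) :
    G.twistedAdjOp u (fun w => G.starSum w (G.nbWalkSum u g r)) v =
      G.starSum v (G.nbWalkSum u g (r + 1)) +
        G.starSum v (fun e => u e (G.nbWalkSum u g r (G.inv e))) := by
  have h : G.twistedAdjOp u (fun w => G.starSum w (G.nbWalkSum u g r)) v =
      G.starSum v fun e => u e (G.starSum (G.t e) (G.nbWalkSum u g r)) := rfl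
  rw [← starSum_add, h]
  refine starSum_congr fun e _ => ?_
  rw [nbWalkSum, ← map_add, ← G.o_inv e, starSum_erase, sub_add_cancel]

/-- The transports of an edge and its inverse cancel in the backtracking term, so the recurrence has
the same coefficients whatever the twist. Index r of `nbWalkSum` means length r + 1, hence `nbPoly q
(r + 1)`. -/
theorem starSum_nbWalkSum {q : ℕ} (hG : G.IsRegular (q + 1)) (u : D → M →ₗ[ℝ] M)
    (hu : ∀ e m, u e (u (G.inv e) m) = m) (g : V → M) (r : ℕ) :
    (fun v => G.starSum v (G.nbWalkSum u g r)) =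
      Polynomial.aeval (G.twistedAdjOp u) (nbPoly q (r + 1)) g := by
  have hrec : ∀ r, (fun v => G.starSum v (G.nbWalkSum u g (r + 2))) =
      G.twistedAdjOp u (fun v => G.starSum v (G.nbWalkSum u g (r + 1))) -
        (q : ℝ) • fun v => G.starSum v (G.nbWalkSum u g r) := fun r => by
    ext v
    rw [Pi.sub_apply, twistedAdjOp_starSum, eq_sub_iff_add_eq, add_right_inj, Pi.smul_apply]
    -- After e and its inverse cancel, what is left is a walk from v that does not start with e.
    -- Summed over the q + 1 choices of e, each walk is counted q times.
    have : G.starSum v (fun e => u e (G.nbWalkSum u g (r + 1) (G.inv e))) =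
        G.starSum v fun e => G.starSum v (G.nbWalkSum u g r) - G.nbWalkSum u g r e :=
      starSum_congr fun e he => by
        rw [nbWalkSum, hu, G.inv_inv, G.t_inv, starSum_erase, he]
    rw [this, starSum_sub, starSum_const hG]
    push_cast
    module
  have h0 : (fun v => G.starSum v (G.nbWalkSum u g 0)) = G.twistedAdjOp u g := rfl
  induction r using Nat.strong_induction_on with
  | _ r ih =>
    match r with
    | 0 => simp [nbPoly, h0]
    | 1 =>
      have : G.twistedAdjOp u (fun v => G.starSum v (G.nbWalkSum u g 0)) =
          (fun v => G.starSum v (G.nbWalkSum u g 1)) + (q + 1 : ℝ) • g := by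
        ext v
        rw [twistedAdjOp_starSum, Pi.add_apply, add_right_inj, Pi.smul_apply]
        rw [starSum_congr (k := fun _ => g v) fun e he => by
          rw [nbWalkSum, hu, G.t_inv, he], starSum_const hG]
        push_cast
        rfl
      rw [← sub_eq_iff_eq_add] at this
      rw [← this, h0]
      simp [nbPoly, add_smul, Nat.cast_smul_eq_nsmul]
    | r + 2 =>
      rw [hrec, ih (r + 1) (by omega), ih r (by omega), nbPoly.eq_4]
      simp [Nat.cast_smul_eq_nsmul]

end NonBacktracking

/-- Triangle inequality over walks: each walk contributes a composition of contractions. -/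
theorem norm_nbWalkSum_le {V D M : Type*} {G : Multigraph V D}
    [∀ v, Fintype {e : D // G.o e = v}] [NormedAddCommGroup M] [Module ℝ M] [DecidableEq D]
    (u : D → M →ₗ[ℝ] M) (hu : ∀ e m, ‖u e m‖ ≤ ‖m‖) (g : V → M) (g' : V → ℝ)
    (hg : ∀ v, ‖g v‖ ≤ g' v) (r : ℕ) (e : D) :
    ‖G.nbWalkSum u g r e‖ ≤ G.nbWalkSum (fun _ => LinearMap.id) g' r e := by
  induction r generalizing e with
  | zero => exact (hu _ _).trans (hg _)
  | succ r ih =>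
    refine (hu _ _).trans ((norm_sum_le _ _).trans (Finset.sum_le_sum fun f _ => ?_))
    by_cases h : f.1 = G.inv e
    · simp [h]
    · simpa [h] using ih f

theorem norm_starSum_nbWalkSum_le {V D M : Type*} {G : Multigraph V D}
    [∀ v, Fintype {e : D // G.o e = v}] [NormedAddCommGroup M] [Module ℝ M] [DecidableEq D]
    (u : D → M →ₗ[ℝ] M) (hu : ∀ e m, ‖u e m‖ ≤ ‖m‖) (g : V → M) (g' : V → ℝ)
    (hg : ∀ v, ‖g v‖ ≤ g' v) (r : ℕ) (v : V) :
    ‖G.starSum v (G.nbWalkSum u g r)‖ ≤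
      G.starSum v (G.nbWalkSum (fun _ => LinearMap.id) g' r) :=
  (norm_sum_le _ _).trans (Finset.sum_le_sum fun f _ => norm_nbWalkSum_le u hu g g' hg r f)

end Multigraph

/-! ### No closed non-backtracking walks in the tree -/

/-- A nonzero sum has a contributing walk, recorded by its edge labels. An edge and its inverse
carry the same label, so non-backtracking makes consecutive labels differ. -/
theorem regularTree_nbWalkSum_ne_zero {d : ℕ} [DecidableEq (FreeInvolutions d)]
    (w : FreeInvolutions d) (r : ℕ)
    (g : FreeInvolutions d) (i : Fin d)
    (h : (regularTree d).nbWalkSum (fun _ => LinearMap.id) (Pi.single w (1 : ℝ)) r (g, i) ≠ 0) :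
    ∃ l : List (Fin d), (i :: l).IsChain (· ≠ ·) ∧
      g * ((i :: l).map FreeInvolutions.gen).prod = w := by
  induction r generalizing g i with
  | zero =>
    refine ⟨[], by simp, ?_⟩
    by_contra hne
    refine h ?_
    have : (regularTree d).t (g, i) ≠ w := by simpa [regularTree] using hne
    simp [Multigraph.nbWalkSum, this]
  | succ r ih =>
    rw [Multigraph.nbWalkSum, LinearMap.id_apply, Multigraph.starSum] at h
    obtain ⟨⟨⟨g', j⟩, hg'⟩, -, hf⟩ := Finset.exists_ne_zero_of_sum_ne_zero h
    have hg : g' = g * FreeInvolutions.gen i := hg'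
    subst hg
    simp only [ne_eq, ite_eq_left_iff, not_forall] at hf
    obtain ⟨hne, hf⟩ := hf
    obtain ⟨l, hl, hw⟩ := ih _ _ hf
    refine ⟨j :: l, List.isChain_cons_cons.2 ⟨?_, hl⟩, ?_⟩
    · rintro rfl
      exact hne rfl
    · rw [← hw]
      simp [mul_assoc]

theorem regularTree_starSum_nbWalkSum {d : ℕ} [DecidableEq (FreeInvolutions d)]
    (g : FreeInvolutions d) (r : ℕ) :
    (regularTree d).starSum g
      ((regularTree d).nbWalkSum (fun _ => LinearMap.id) (Pi.single g (1 : ℝ)) r) = 0 := by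
  refine Finset.sum_eq_zero fun e _ => ?_
  by_contra h
  obtain ⟨⟨g', i⟩, hg'⟩ := e
  obtain ⟨l, hl, hw⟩ := regularTree_nbWalkSum_ne_zero g r g' i h
  obtain rfl : g' = g := hg'
  exact regularTree_acyclic g' (i :: l) (by simp) hl hw

/-- The Kesten–McKay law integrates the non-backtracking polynomials of positive degree to `0`. -/
theorem integral_kestenMcKay_nbPoly {q : ℕ} (hq : 1 ≤ q) (r : ℕ) :
    ∫ x, ((nbPoly q (r + 1)).comp (Polynomial.C (Real.sqrt q) * Polynomial.X)).eval x
      ∂(kestenMcKay q : Measure ℝ) = 0 := by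
  classical
  have hs : Real.sqrt q ≠ 0 := by
    rw [Real.sqrt_ne_zero (by positivity)]; exact_mod_cast (by omega : q ≠ 0)
  -- Substituting √q X undoes the normalization q^{-1/2} and leaves the polynomial in the adjacency
  -- operator itself.
  rw [(kestenMcKay_spec q).2, Polynomial.aeval_comp]
  simp only [map_mul, Polynomial.aeval_C, Polynomial.aeval_X, Algebra.algebraMap_eq_smul_one,
    smul_mul_assoc, one_mul, smul_smul, mul_inv_cancel₀ hs, one_smul]
  rw [← Multigraph.twistedAdjOp_id]
  convert regularTree_starSum_nbWalkSum (d := q + 1) 1 r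
  exact (congrFun (Multigraph.starSum_nbWalkSum (regularTree_isRegular (q + 1)) _
    (fun _ _ => rfl) _ r) 1).symm

/-! ### Weak convergence tested on polynomials -/

/-- For probability measures on a common compact interval, weak convergence is convergence of the
integrals of all polynomials. -/
theorem tendsto_iff_forall_integral_polynomial {R : ℝ} (μ : ℕ → ProbabilityMeasure ℝ)
    (ν : ProbabilityMeasure ℝ) (hμ : ∀ n, ∀ᵐ x ∂(μ n : Measure ℝ), x ∈ Set.Icc (-R) R)
    (hν : ∀ᵐ x ∂(ν : Measure ℝ), x ∈ Set.Icc (-R) R) :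
    Tendsto μ atTop (𝓝 ν) ↔ ∀ P : Polynomial ℝ,
      Tendsto (fun n => ∫ x, P.eval x ∂(μ n : Measure ℝ)) atTop
        (𝓝 (∫ x, P.eval x ∂(ν : Measure ℝ))) := by
  have hR : -R ≤ R := by
    obtain ⟨x, hx⟩ := hν.exists
    exact hx.1.trans hx.2
  -- the bounded continuous function that agrees with a polynomial on the interval
  let F : Polynomial ℝ → BoundedContinuousFunction ℝ ℝ := fun P =>
    (BoundedContinuousFunction.mkOfCompact
      (⟨fun x : Set.Icc (-R) R => P.eval (x : ℝ), by fun_prop⟩ : C(Set.Icc (-R) R, ℝ))).compContinuous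
      ⟨Set.projIcc (-R) R hR, continuous_projIcc⟩
  have hF : ∀ P, ∀ x ∈ Set.Icc (-R) R, F P x = P.eval x := fun P x hx =>
    congrArg (fun y : Set.Icc (-R) R => P.eval (y : ℝ)) (Set.projIcc_of_mem hR hx)
  have hint : ∀ (P) (ρ : ProbabilityMeasure ℝ), (∀ᵐ x ∂(ρ : Measure ℝ), x ∈ Set.Icc (-R) R) →
      ∫ x, F P x ∂(ρ : Measure ℝ) = ∫ x, P.eval x ∂(ρ : Measure ℝ) := fun P ρ hρ =>
    integral_congr_ae (hρ.mono fun x hx => hF P x hx)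
  rw [ProbabilityMeasure.tendsto_iff_forall_integral_tendsto]
  constructor
  · intro h P
    simpa only [hint P _ (hμ _), hint P _ hν] using h (F P)
  · intro h f
    rw [Metric.tendsto_atTop]
    intro ε hε
    -- Weierstrass approximation: one ε/3 for each of the two measures, one for the convergence of
    -- the integrals of P.
    obtain ⟨P, hP⟩ := exists_polynomial_near_of_continuousOn (-R) R f f.continuous.continuousOn
      (ε / 3) (by positivity)
    have key : ∀ ρ : ProbabilityMeasure ℝ, (∀ᵐ x ∂(ρ : Measure ℝ), x ∈ Set.Icc (-R) R) →
        |∫ x, P.eval x ∂(ρ : Measure ℝ) - ∫ x, f x ∂(ρ : Measure ℝ)| ≤ ε / 3 := fun ρ hρ => by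
      rw [← hint P ρ hρ, ← integral_sub ((F P).integrable _) (f.integrable _)]
      rw [← Real.norm_eq_abs]
      refine (norm_integral_le_of_norm_le_const (C := ε / 3) (hρ.mono fun x hx => ?_)).trans ?_
      · rw [hF P x hx]
        exact (hP x hx).le
      · simp
    obtain ⟨n₀, hn₀⟩ := Metric.tendsto_atTop.1 (h P) (ε / 3) (by positivity)
    refine ⟨n₀, fun n hn => ?_⟩
    have h1 := abs_le.1 (key (μ n) (hμ n))
    have h2 := abs_le.1 (key ν hν)
    have h3 := hn₀ n hn
    rw [Real.dist_eq, abs_lt] at h3 ⊢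
    constructor <;> linarith [h1.1, h1.2, h2.1, h2.2, h3.1, h3.2]

/-! ### Empirical spectral measures and traces -/

section Empirical

variable {𝕜 ι : Type*} [RCLike 𝕜] [Fintype ι] [DecidableEq ι]

theorem Matrix.IsHermitian.trace_aeval {A : Matrix ι ι 𝕜} (hA : A.IsHermitian)
    (P : Polynomial ℝ) :
    (Polynomial.aeval A P).trace = ((∑ k, P.eval (hA.eigenvalues k) : ℝ) : 𝕜) := by
  rw [← cfc_polynomial P A hA.isSelfAdjoint, hA.cfc_eq, Matrix.IsHermitian.cfc,
    Unitary.conjStarAlgAut_apply, Matrix.trace_mul_comm, ← mul_assoc, Unitary.coe_star_mul_self,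
    one_mul, Matrix.trace_diagonal]
  simp

variable [Nonempty ι] {A : Matrix ι ι 𝕜} (hA : A.IsHermitian)

theorem integral_empiricalSpectralMeasure (c : ℝ) (f : ℝ → ℝ) :
    ∫ x, f x ∂(empiricalSpectralMeasure c hA : Measure ℝ) =
      (Fintype.card ι : ℝ)⁻¹ * ∑ k, f (c * hA.eigenvalues k) := by
  rw [empiricalSpectralMeasure, ProbabilityMeasure.coe_mk, integral_smul_measure,
    integral_finsetSum_measure fun k _ => integrable_dirac (by simp)]
  simp

/-- The integral of a rescaled polynomial is a normalized trace. -/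
theorem integral_empiricalSpectralMeasure_comp {s : ℝ} (hs : s ≠ 0) (P : Polynomial ℝ) :
    ∫ x, (P.comp (Polynomial.C s * Polynomial.X)).eval x
      ∂(empiricalSpectralMeasure s⁻¹ hA : Measure ℝ) =
      (Fintype.card ι : ℝ)⁻¹ * RCLike.re (Polynomial.aeval A P).trace := by
  rw [integral_empiricalSpectralMeasure, hA.trace_aeval, RCLike.ofReal_re]
  simp [Polynomial.eval_comp, mul_inv_cancel_left₀ hs]

theorem ae_empiricalSpectralMeasure {c R : ℝ} (h : ∀ k, |c * hA.eigenvalues k| ≤ R) :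
    ∀ᵐ x ∂(empiricalSpectralMeasure c hA : Measure ℝ), x ∈ Set.Icc (-R) R := by
  rw [empiricalSpectralMeasure, ProbabilityMeasure.coe_mk]
  refine Measure.ae_smul_measure ?_ _
  rw [← Measure.sum_fintype, Measure.ae_sum_iff]
  intro k
  refine (ae_dirac_iff measurableSet_Icc).2 ?_
  exact abs_le.1 (h k)

end Empirical

/-! ### Polynomials of intertwined operators -/

theorem LinearMap.aeval_apply_of_intertwine {W W' : Type*} [AddCommGroup W] [Module ℝ W]
    [AddCommGroup W'] [Module ℝ W'] {S : W →ₗ[ℝ] W} {T : W' →ₗ[ℝ] W'} (ρ : W →ₗ[ℝ] W')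
    (h : ∀ f, ρ (S f) = T (ρ f)) (P : Polynomial ℝ) (f : W) :
    ρ (Polynomial.aeval S P f) = Polynomial.aeval T P (ρ f) := by
  induction P using Polynomial.induction_on' generalizing f with
  | add P Q hP hQ => simp [hP, hQ]
  | monomial n a =>
    simp only [Polynomial.aeval_monomial, Module.End.mul_apply, Module.algebraMap_end_apply,
      map_smul]
    congr 1
    induction n generalizing f with
    | zero => simp
    | succ n ih => rw [pow_succ, pow_succ, Module.End.mul_apply, Module.End.mul_apply, ih, h]

theorem Matrix.aeval_mulVec {𝕜 ι : Type*} [RCLike 𝕜] [Fintype ι] [DecidableEq ι]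
    (A : Matrix ι ι 𝕜) (P : Polynomial ℝ) (f : ι → 𝕜) :
    (Polynomial.aeval A P).mulVec f =
      Polynomial.aeval (A.mulVecLin.restrictScalars ℝ) P f := by
  induction P using Polynomial.induction_on' generalizing f with
  | add P Q hP hQ => simp [Matrix.add_mulVec, hP, hQ]
  | monomial n a =>
    simp only [Polynomial.aeval_monomial, ← Algebra.smul_def, Matrix.smul_mulVec]
    congr 1
    induction n generalizing f with
    | zero => simp
    | succ n ih => rw [pow_succ, pow_succ, Module.End.mul_apply, ← Matrix.mulVec_mulVec, ih]; rfl

theorem Matrix.map_aeval_mulVec_of_intertwine {𝕜 ι W : Type*} [RCLike 𝕜] [Fintype ι]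
    [DecidableEq ι] [AddCommGroup W] [Module ℝ W] {A : Matrix ι ι 𝕜} {T : W →ₗ[ℝ] W}
    (ρ : (ι → 𝕜) →ₗ[ℝ] W) (h : ∀ f, ρ (A.mulVec f) = T (ρ f)) (P : Polynomial ℝ) (f : ι → 𝕜) :
    ρ ((Polynomial.aeval A P).mulVec f) = Polynomial.aeval T P (ρ f) := by
  rw [Matrix.aeval_mulVec]
  exact LinearMap.aeval_apply_of_intertwine ρ h P f

/-! ### Finite graphs and their colors -/

namespace Multigraph

/-- The eigenvalues of the twisted adjacency operator are bounded by the degree. -/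
theorem abs_le_of_twistedAdjOp_eq_smul {V D M : Type*} [Finite V] {G : Multigraph V D}
    [∀ v, Fintype {e : D // G.o e = v}] [NormedAddCommGroup M] [NormedSpace ℝ M]
    {d : ℕ} (hG : G.IsRegular d) (u : D → M →ₗ[ℝ] M) (hu : ∀ e m, ‖u e m‖ ≤ ‖m‖)
    {g : V → M} (hg : g ≠ 0) {c : ℝ} (h : G.twistedAdjOp u g = c • g) : |c| ≤ d := by
  obtain ⟨w, hw⟩ := Function.ne_iff.1 hg
  have : Nonempty V := ⟨w⟩
  -- Maximum principle: compare both sides of the eigenvalue equation where ‖g‖ is largest.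
  obtain ⟨v, hv⟩ := Finite.exists_max fun v => ‖g v‖
  have hpos : 0 < ‖g v‖ := (norm_pos_iff.2 hw).trans_le (hv w)
  refine le_of_mul_le_mul_right ?_ hpos
  calc |c| * ‖g v‖ = ‖G.twistedAdjOp u g v‖ := by
        rw [h, Pi.smul_apply, norm_smul, Real.norm_eq_abs]
    _ ≤ G.starSum v fun _ => ‖g v‖ :=
        (norm_sum_le _ _).trans (Finset.sum_le_sum fun e _ => (hu _ _).trans (hv _))
    _ = d * ‖g v‖ := by rw [starSum_const hG, smul_eq_mul]

section Transport

variable {V D : Type*} {G : Multigraph V D} {N : ℕ} {𝒢 : Subgroup (Matrix.unitaryGroup (Fin N) ℂ)}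


/-- The unitary matrix of a directed edge, acting on the Euclidean space. -/
def Color.transport (σ : G.Color 𝒢) (e : D) :
    EuclideanSpace ℂ (Fin N) →ₗ[ℝ] EuclideanSpace ℂ (Fin N) :=
  (Matrix.toEuclideanLin (σ.mat e)).restrictScalars ℝ

theorem Color.transport_apply (σ : G.Color 𝒢) (e : D) (m : EuclideanSpace ℂ (Fin N)) :
    σ.transport e m = WithLp.toLp 2 ((σ.mat e).mulVec m.ofLp) := rfl

theorem Color.transport_inv (σ : G.Color 𝒢) (e : D) (m : EuclideanSpace ℂ (Fin N)) :
    σ.transport e (σ.transport (G.inv e) m) = m := by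
  have : σ.mat e * star (σ.mat e) = 1 :=
    Unitary.mul_star_self_of_mem (σ.toFun e : Matrix.unitaryGroup (Fin N) ℂ).2
  rw [transport_apply, transport_apply, Matrix.mulVec_mulVec, σ.mat_inv, this, Matrix.one_mulVec]

open scoped Matrix.Norms.L2Operator in
theorem Color.norm_transport_le (σ : G.Color 𝒢) (e : D) (m : EuclideanSpace ℂ (Fin N)) :
    ‖σ.transport e m‖ ≤ ‖m‖ := by
  refine (Matrix.l2_opNorm_mulVec (σ.mat e) m).trans ?_
  -- N = 0 is allowed here, and then unitary matrices have norm 0 instead of 1.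
  rcases subsingleton_or_nontrivial (Matrix (Fin N) (Fin N) ℂ) with h | h
  · rw [Subsingleton.elim (σ.mat e) 0, norm_zero, zero_mul]
    exact norm_nonneg _
  · have : ‖σ.mat e‖ = 1 :=
      CStarRing.norm_of_mem_unitary (σ.toFun e : Matrix.unitaryGroup (Fin N) ℂ).2
    rw [this, one_mul]

end Transport

section Finite

variable {V D : Type*} [Fintype V] [DecidableEq V] [Fintype D] {G : Multigraph V D}
  {N : ℕ} {𝒢 : Subgroup (Matrix.unitaryGroup (Fin N) ℂ)}

theorem adjMatrix_mulVec (f : V → ℝ) : G.adjMatrix.mulVec f = G.adjOp f := by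
  ext v
  simp only [Matrix.mulVec, dotProduct, adjMatrix, Matrix.of_apply, Finset.sum_mul]
  rw [Finset.sum_comm]
  have : ∀ e, ∑ w, (if G.o e = v ∧ G.t e = w then (1 : ℝ) else 0) * f w =
      if G.o e = v then f (G.t e) else 0 := fun e => by
    by_cases h : G.o e = v <;> simp [h]
  simp only [this]
  rw [← Finset.sum_filter, ← Finset.sum_subtype_eq_sum_filter, Finset.subtype_univ]
  rfl

/-- Regards a function on `V × Fin N` as a vector-valued function on `V`. -/
def blockVec (V : Type*) (N : ℕ) : (V × Fin N → ℂ) →ₗ[ℝ] (V → EuclideanSpace ℂ (Fin N)) where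
  toFun f v := WithLp.toLp 2 fun i => f (v, i)
  map_add' _ _ := rfl
  map_smul' _ _ := rfl

theorem blockVec_apply {V : Type*} {N : ℕ} (f : V × Fin N → ℂ) (v : V) (i : Fin N) :
    blockVec V N f v i = f (v, i) := rfl

theorem Color.adjMatrix_mulVec (σ : G.Color 𝒢) (f : V × Fin N → ℂ) (v : V) (i : Fin N) :
    σ.adjMatrix.mulVec f (v, i) =
      ∑ e : {e : D // G.o e = v}, ∑ j, σ.mat e i j * f (G.t e, j) := by
  simp only [Matrix.mulVec, dotProduct, Color.adjMatrix, Matrix.of_apply, Finset.sum_mul]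
  rw [Finset.sum_comm]
  have : ∀ e, ∑ y : V × Fin N, (if G.o e = v ∧ G.t e = y.1 then σ.mat e i y.2 else 0) * f y =
      if G.o e = v then ∑ j, σ.mat e i j * f (G.t e, j) else 0 := fun e => by
    rw [Fintype.sum_prod_type_right]
    by_cases h : G.o e = v <;> simp [h]
  simp only [this]
  rw [← Finset.sum_filter, ← Finset.sum_subtype_eq_sum_filter, Finset.subtype_univ]

/-- This identification lets the walk expansion apply to the block matrix. -/
theorem Color.blockVec_mulVec (σ : G.Color 𝒢) (f : V × Fin N → ℂ) :
    blockVec V N (σ.adjMatrix.mulVec f) = G.twistedAdjOp σ.transport (blockVec V N f) := by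
  ext v i
  have h : ∀ h : D → EuclideanSpace ℂ (Fin N), G.starSum v h i =
    ∑ e : {e : D // G.o e = v}, h e i := fun h => by simp [starSum]
  exact (σ.adjMatrix_mulVec f v i).trans
    (h fun e => σ.transport e (blockVec V N f (G.t e))).symm

theorem adjMatrix_abs_eigenvalues_le {d : ℕ} (hG : G.IsRegular d) (k : V) :
    |G.adjMatrix_isHermitian.eigenvalues k| ≤ d := by
  refine abs_le_of_twistedAdjOp_eq_smul hG (fun _ => LinearMap.id) (fun _ _ => le_rfl)
    (g := (G.adjMatrix_isHermitian.eigenvectorBasis k).ofLp) ?_ ?_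
  · intro h
    refine G.adjMatrix_isHermitian.eigenvectorBasis.orthonormal.ne_zero k ?_
    exact (WithLp.ofLp_eq_zero 2).1 h
  · rw [twistedAdjOp_id, ← adjMatrix_mulVec, Matrix.IsHermitian.mulVec_eigenvectorBasis]

theorem Color.abs_eigenvalues_le (σ : G.Color 𝒢) {d : ℕ} (hG : G.IsRegular d) (k : V × Fin N) :
    |σ.adjMatrix_isHermitian.eigenvalues k| ≤ d := by
  refine abs_le_of_twistedAdjOp_eq_smul hG σ.transport σ.norm_transport_le
    (g := blockVec V N (σ.adjMatrix_isHermitian.eigenvectorBasis k).ofLp) ?_ ?_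
  · intro h
    refine σ.adjMatrix_isHermitian.eigenvectorBasis.orthonormal.ne_zero k ?_
    ext ⟨v, i⟩
    exact congrArg (fun g => g v i) h
  · rw [← σ.blockVec_mulVec, Matrix.IsHermitian.mulVec_eigenvectorBasis, map_smul]

theorem aeval_adjMatrix_diag (P : Polynomial ℝ) (v : V) :
    Polynomial.aeval G.adjMatrix P v v = Polynomial.aeval G.adjOp P (Pi.single v 1) v := by
  have := Matrix.map_aeval_mulVec_of_intertwine LinearMap.id
    (fun f => adjMatrix_mulVec (G := G) f) P (Pi.single v 1)
  rw [LinearMap.id_apply, LinearMap.id_apply, Matrix.mulVec_single_one] at this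
  exact congrFun this v

theorem Color.aeval_adjMatrix_diag (σ : G.Color 𝒢) (P : Polynomial ℝ) (v : V) (i : Fin N) :
    Polynomial.aeval σ.adjMatrix P (v, i) (v, i) =
      Polynomial.aeval (G.twistedAdjOp σ.transport) P
        (blockVec V N (Pi.single (v, i) 1)) v i := by
  have := Matrix.map_aeval_mulVec_of_intertwine (blockVec V N) σ.blockVec_mulVec P
    (Pi.single (v, i) 1)
  rw [Matrix.mulVec_single_one] at this
  exact congrArg (fun g => g v i) this

/-- The left entry is a coordinate of a sum, over closed non-backtracking walks at v, of unitaries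
applied to a unit vector; the right entry counts these walks. -/
theorem Color.norm_aeval_nbPoly_diag_le (σ : G.Color 𝒢) {q : ℕ} (hG : G.IsRegular (q + 1))
    (r : ℕ) (v : V) (i : Fin N) :
    ‖Polynomial.aeval σ.adjMatrix (nbPoly q (r + 1)) (v, i) (v, i)‖ ≤
      Polynomial.aeval G.adjMatrix (nbPoly q (r + 1)) v v := by
  classical
  rw [Multigraph.aeval_adjMatrix_diag, σ.aeval_adjMatrix_diag, ← twistedAdjOp_id,
    ← starSum_nbWalkSum hG _ σ.transport_inv, ← starSum_nbWalkSum hG _ fun _ _ => rfl]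
  refine (PiLp.norm_apply_le _ i).trans ?_
  refine norm_starSum_nbWalkSum_le _ σ.norm_transport_le _ _ (fun w => ?_) r v
  by_cases h : w = v
  · subst h
    have : blockVec V N (Pi.single (w, i) 1) w = EuclideanSpace.single i 1 := by
      ext j
      rw [blockVec_apply]
      simp [Pi.single_apply]
    simp [this]
  · have : blockVec V N (Pi.single (v, i) 1) w = 0 := by
      ext j
      rw [blockVec_apply]
      simp [h]
    simp [this, h]

theorem Color.norm_trace_aeval_nbPoly_le (σ : G.Color 𝒢) {q : ℕ} (hG : G.IsRegular (q + 1))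
    (r : ℕ) :
    ‖(Polynomial.aeval σ.adjMatrix (nbPoly q (r + 1))).trace‖ ≤
      N * (Polynomial.aeval G.adjMatrix (nbPoly q (r + 1))).trace := by
  refine (norm_sum_le _ _).trans ?_
  rw [Matrix.trace, Fintype.sum_prod_type, Finset.mul_sum]
  refine Finset.sum_le_sum fun v _ => ?_
  refine (Finset.sum_le_sum fun i _ => σ.norm_aeval_nbPoly_diag_le hG r v i).trans ?_
  simp

/-- The color with all values equal to the identity. -/
def trivialColor (G : Multigraph V D) (𝒢 : Subgroup (Matrix.unitaryGroup (Fin N) ℂ)) :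
    G.Color 𝒢 where
  toFun _ := 1
  map_inv _ := inv_one.symm

/-- A function on `V`, placed in the `i`-th coordinate. -/
def coordVec (V : Type*) {N : ℕ} (i : Fin N) : (V → ℝ) →ₗ[ℝ] (V × Fin N → ℂ) where
  toFun f x := if x.2 = i then (f x.1 : ℂ) else 0
  map_add' f g := by ext x; by_cases h : x.2 = i <;> simp [h]
  map_smul' c f := by ext x; by_cases h : x.2 = i <;> simp [h]

/-- With the trivial color the matrix is A ⊗ 1, so each coordinate carries its own copy of A. -/
theorem coordVec_mulVec (i : Fin N) (f : V → ℝ) :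
    coordVec V i (G.adjMatrix.mulVec f) =
      ((trivialColor G 𝒢).adjMatrix.mulVecLin.restrictScalars ℝ) (coordVec V i f) := by
  ext ⟨v, j⟩
  have h1 : ∀ e, (trivialColor G 𝒢).mat e = 1 := fun e => rfl
  refine Eq.trans ?_ ((trivialColor G 𝒢).adjMatrix_mulVec _ v j).symm
  rw [adjMatrix_mulVec]
  by_cases h : j = i
  · subst h
    simp [coordVec, h1, adjOp, Matrix.one_apply]
  · simp [coordVec, h1, Matrix.one_apply, h]

theorem trace_aeval_trivialColor (P : Polynomial ℝ) :
    (Polynomial.aeval (trivialColor G 𝒢).adjMatrix P).trace =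
      ((N * (Polynomial.aeval G.adjMatrix P).trace : ℝ) : ℂ) := by
  have key : ∀ v i, Polynomial.aeval (trivialColor G 𝒢).adjMatrix P (v, i) (v, i) =
      ((Polynomial.aeval G.adjMatrix P v v : ℝ) : ℂ) := fun v i => by
    have h1 := Matrix.map_aeval_mulVec_of_intertwine (coordVec V i)
      (coordVec_mulVec (G := G) (𝒢 := 𝒢) i) P (Pi.single v 1)
    have h2 : coordVec V i (Pi.single v 1) = Pi.single (v, i) 1 := by
      ext ⟨w, j⟩
      by_cases hw : w = v <;> by_cases hj : j = i <;> simp [coordVec, hw, hj]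
    rw [h2, ← Matrix.aeval_mulVec, Matrix.mulVec_single_one, Matrix.mulVec_single_one] at h1
    have h3 := congrFun h1 (v, i)
    simpa [coordVec] using h3.symm
  rw [Matrix.trace, Fintype.sum_prod_type]
  simp [key, Matrix.trace, Finset.mul_sum]

variable [Nonempty V] [NeZero N]

/-- The interval depends on q alone, so it serves a whole sequence of graphs. -/
theorem ae_spectralMeasure {q : ℕ} (hG : G.IsRegular (q + 1)) :
    ∀ᵐ x ∂(G.spectralMeasure q : Measure ℝ),
      x ∈ Set.Icc (-((Real.sqrt q)⁻¹ * (q + 1 : ℕ))) ((Real.sqrt q)⁻¹ * (q + 1 : ℕ)) := by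
  refine ae_empiricalSpectralMeasure _ fun k => ?_
  rw [abs_mul, abs_of_nonneg (by positivity)]
  exact mul_le_mul_of_nonneg_left (adjMatrix_abs_eigenvalues_le hG k) (by positivity)

theorem Color.ae_spectralMeasure (σ : G.Color 𝒢) {q : ℕ} (hG : G.IsRegular (q + 1)) :
    ∀ᵐ x ∂(σ.spectralMeasure q : Measure ℝ),
      x ∈ Set.Icc (-((Real.sqrt q)⁻¹ * (q + 1 : ℕ))) ((Real.sqrt q)⁻¹ * (q + 1 : ℕ)) := by
  refine ae_empiricalSpectralMeasure _ fun k => ?_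
  rw [abs_mul, abs_of_nonneg (by positivity)]
  exact mul_le_mul_of_nonneg_left (σ.abs_eigenvalues_le hG k) (by positivity)

theorem integral_spectralMeasure_trivialColor {q : ℕ} (hq : Real.sqrt q ≠ 0)
    (P : Polynomial ℝ) :
    ∫ x, (P.comp (Polynomial.C (Real.sqrt q) * Polynomial.X)).eval x
        ∂((trivialColor G 𝒢).spectralMeasure q : Measure ℝ) =
      ∫ x, (P.comp (Polynomial.C (Real.sqrt q) * Polynomial.X)).eval x
        ∂(G.spectralMeasure q : Measure ℝ) := by
  have hN : (N : ℝ) ≠ 0 := Nat.cast_ne_zero.2 (NeZero.ne N)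
  rw [spectralMeasure, Color.spectralMeasure, integral_empiricalSpectralMeasure_comp _ hq,
    integral_empiricalSpectralMeasure_comp _ hq, trace_aeval_trivialColor]
  simp only [Fintype.card_prod, Fintype.card_fin, RCLike.re_to_real, Nat.cast_mul, mul_inv,
    RCLike.re_to_complex, Complex.ofReal_re, mul_assoc, inv_mul_cancel_left₀ hN]

/-- The N coordinates over each vertex give a factor N in the trace bound, which the normalization
1/(N|V|) absorbs. -/
theorem Color.abs_integral_nbPoly_le (σ : G.Color 𝒢) {q : ℕ} (hq : Real.sqrt q ≠ 0)
    (hG : G.IsRegular (q + 1)) (r : ℕ) :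
    |∫ x, ((nbPoly q (r + 1)).comp (Polynomial.C (Real.sqrt q) * Polynomial.X)).eval x
        ∂(σ.spectralMeasure q : Measure ℝ)| ≤
      ∫ x, ((nbPoly q (r + 1)).comp (Polynomial.C (Real.sqrt q) * Polynomial.X)).eval x
        ∂(G.spectralMeasure q : Measure ℝ) := by
  have hN : (N : ℝ) ≠ 0 := Nat.cast_ne_zero.2 (NeZero.ne N)
  rw [Multigraph.spectralMeasure, Color.spectralMeasure,
    integral_empiricalSpectralMeasure_comp _ hq, integral_empiricalSpectralMeasure_comp _ hq,
    abs_mul, abs_of_nonneg (by positivity)]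
  refine (mul_le_mul_of_nonneg_left ((Complex.abs_re_le_norm _).trans
    (σ.norm_trace_aeval_nbPoly_le hG r)) (by positivity)).trans_eq ?_
  simp only [Fintype.card_prod, Fintype.card_fin, RCLike.re_to_real, Nat.cast_mul, mul_inv,
    mul_assoc, inv_mul_cancel_left₀ hN]

end Finite

end Multigraph

/-! ### Reduction to non-backtracking polynomials and conclusion -/

/-- For measures on a common compact interval, convergence of the integrals of the rescaled
non-backtracking polynomials is weak convergence. -/
theorem tendsto_iff_forall_integral_nbPoly {q : ℕ} (hq : Real.sqrt q ≠ 0) {R : ℝ}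
    (μ : ℕ → ProbabilityMeasure ℝ) (ν : ProbabilityMeasure ℝ)
    (hμ : ∀ n, ∀ᵐ x ∂(μ n : Measure ℝ), x ∈ Set.Icc (-R) R)
    (hν : ∀ᵐ x ∂(ν : Measure ℝ), x ∈ Set.Icc (-R) R) :
    Tendsto μ atTop (𝓝 ν) ↔ ∀ r,
      Tendsto (fun n => ∫ x, ((nbPoly q (r + 1)).comp
        (Polynomial.C (Real.sqrt q) * Polynomial.X)).eval x ∂(μ n : Measure ℝ)) atTop
        (𝓝 (∫ x, ((nbPoly q (r + 1)).comp
          (Polynomial.C (Real.sqrt q) * Polynomial.X)).eval x ∂(ν : Measure ℝ))) := by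
  rw [tendsto_iff_forall_integral_polynomial μ ν hμ hν]
  refine ⟨fun h r => h _, fun h => ?_⟩
  have hint : ∀ (P : Polynomial ℝ) (ρ : ProbabilityMeasure ℝ),
      (∀ᵐ x ∂(ρ : Measure ℝ), x ∈ Set.Icc (-R) R) →
        Integrable (fun x => P.eval x) (ρ : Measure ℝ) := fun P ρ hρ => by
    obtain ⟨C, hC⟩ := (isCompact_Icc (a := -R) (b := R)).exists_bound_of_continuousOn
      P.continuous.continuousOn
    exact Integrable.of_bound P.continuous.aestronglyMeasurable C (hρ.mono fun x hx => hC x hx)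
  let S : Submodule ℝ (Polynomial ℝ) :=
    { carrier := {P | Tendsto (fun n => ∫ x, (P.comp
        (Polynomial.C (Real.sqrt q) * Polynomial.X)).eval x ∂(μ n : Measure ℝ)) atTop
        (𝓝 (∫ x, (P.comp
          (Polynomial.C (Real.sqrt q) * Polynomial.X)).eval x ∂(ν : Measure ℝ)))}
      zero_mem' := by simp
      add_mem' := fun {P Q} hP hQ => by
        simp only [Set.mem_ofPred_eq, Polynomial.add_comp, Polynomial.eval_add]
        simp only [integral_add (hint _ _ (hμ _)) (hint _ _ (hμ _)),
          integral_add (hint _ _ hν) (hint _ _ hν)]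
        exact Tendsto.add hP hQ
      smul_mem' := fun c P hP => by
        simp only [Set.mem_ofPred_eq, Polynomial.smul_comp, Polynomial.eval_smul]
        simp only [integral_smul]
        exact Tendsto.const_smul hP c }
  have hS : S = ⊤ := span_nbPoly q S fun r => by
    cases r with
    -- Degree 0 is free: all the measures have mass 1.
    | zero => simp [S, nbPoly]
    | succ r => exact h r
  intro P
  -- Since √q ≠ 0, every polynomial is a rescaled one.
  have hP : P.comp (Polynomial.C (Real.sqrt q)⁻¹ * Polynomial.X) ∈ S := hS ▸ Submodule.mem_top
  have hP' : (P.comp (Polynomial.C (Real.sqrt q)⁻¹ * Polynomial.X)).comp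
      (Polynomial.C (Real.sqrt q) * Polynomial.X) = P := by
    rw [Polynomial.comp_assoc, Polynomial.mul_comp, Polynomial.C_comp, Polynomial.X_comp,
      ← mul_assoc, ← Polynomial.C_mul, inv_mul_cancel₀ hq, Polynomial.C_1, one_mul,
      Polynomial.comp_X]
  simp only [S, Submodule.mem_mk, AddSubmonoid.mem_mk, AddSubsemigroup.mem_mk, Set.mem_ofPred_eq,
    hP'] at hP
  exact hP

theorem theorem3p1 {V D : ℕ → Type*} [∀ n, Fintype (V n)] [∀ n, DecidableEq (V n)]
    [∀ n, Nonempty (V n)] [∀ n, Fintype (D n)]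
    (q : ℕ) (hq : 1 ≤ q)
    (G : ∀ n, Multigraph (V n) (D n)) (hG : ∀ n, (G n).IsRegular (q + 1))
    (N : ℕ → ℕ) [∀ n, NeZero (N n)]
    (𝒢 : ∀ n, Subgroup (Matrix.unitaryGroup (Fin (N n)) ℂ)) :
    Tendsto (fun n => (G n).spectralMeasure q) atTop (𝓝 (kestenMcKay q)) ↔
      ∀ σ : ∀ n, (G n).Color (𝒢 n),
        Tendsto (fun n => (σ n).spectralMeasure q) atTop (𝓝 (kestenMcKay q)) := by
  have hs : Real.sqrt q ≠ 0 := (Real.sqrt_pos.2 (by exact_mod_cast hq)).ne'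
  obtain ⟨R₀, hR₀⟩ := (kestenMcKay_spec q).1
  have hmono : ∀ {a b : ℝ}, a ≤ b → Set.Icc (-a) a ⊆ Set.Icc (-b) b := fun h =>
    Set.Icc_subset_Icc (neg_le_neg h) h
  have hν : ∀ᵐ x ∂(kestenMcKay q : Measure ℝ),
      x ∈ Set.Icc (-max R₀ ((Real.sqrt q)⁻¹ * (q + 1 : ℕ)))
        (max R₀ ((Real.sqrt q)⁻¹ * (q + 1 : ℕ))) :=
    (show ∀ᵐ x ∂(kestenMcKay q : Measure ℝ), x ∈ Set.Icc (-R₀) R₀ from hR₀).mono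
      fun x hx => hmono (le_max_left _ _) hx
  rw [tendsto_iff_forall_integral_nbPoly hs _ _ (fun n =>
    (Multigraph.ae_spectralMeasure (hG n)).mono fun x hx => hmono (le_max_right _ _) hx) hν]
  have hσ : ∀ σ : ∀ n, (G n).Color (𝒢 n), _ := fun σ =>
    tendsto_iff_forall_integral_nbPoly hs (fun n => (σ n).spectralMeasure q) (kestenMcKay q)
      (fun n => ((σ n).ae_spectralMeasure (hG n)).mono fun x hx => hmono (le_max_right _ _) hx) hν
  constructor
  · intro h σ
    rw [hσ]
    intro r
    specialize h r
    rw [integral_kestenMcKay_nbPoly hq] at h ⊢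
    -- The one-sided bound suffices because the limit is 0.
    exact squeeze_zero_norm (fun n => (σ n).abs_integral_nbPoly_le hs (hG n) r) h
  · intro h r
    have := (hσ _).1 (h fun n => (G n).trivialColor (𝒢 n)) r
    simpa only [Multigraph.integral_spectralMeasure_trivialColor hs] using this

end
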